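/- Let $\mathcal C$ be an (essentially small) triangulated category. A stability condition $\sigma=(Z_\sigma,\mathcal P_\sigma)$ on $\mathcal C$ consists of a homomorphism $Z_\sigma:K(\mathcal C)\to\mathbb C$ from the Grothendieck group and strict full additive subcategories $\mathcal P_\sigma(\varphi)\subset\mathcal C$ for $\varphi\in\mathbb R$ such that: (1) if $0\ne c\in\mathcal P_\sigma(\varphi)$ then $Z_\sigma(c)=m\,e^{i\pi\varphi}$ with $m>0$; (2) $\mathcal P_\sigma(\varphi+1)=\mathcal P_\sigma(\varphi)[1]$; (3) $\operatorname{Hom}(c,c')=0$ if $c\in\mathcal P_\sigma(\varphi)$, $c'\in\mathcal P_\sigma(\varphi')$ and $\varphi>\varphi'$; (4) every $c\ne0$ has a Harder–Narasimhan filtration, i.e. there are exact triangles $c_{j-1}\to c_j\to b_j\to c_{j-1}[1]$, $1\le j\le n$, with $c_0=0$, $c_n=c$, $0\neq b_j\in\mathcal P_\sigma(\varphi_j)$ and $\varphi_1>\dots>\varphi_n$. Put $\varphi_\sigma^+(c)=\varphi_1$, $\varphi_\sigma^-(c)=\varphi_n$ and $m_\sigma(c)=\sum_j|Z_\sigma(b_j)|$.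 For a collection $S$ of objects let $\langle S\rangle$ be the smallest strict full subcategory of $\mathcal C$ that contains $S$ and the zero objects and is closed under extensions (if $a\to b\to c\to a[1]$ is an exact triangle with $a$ and $c$ in it, then $b$ is in it). Put $\mathcal P_\sigma(I)=\langle\mathcal P_\sigma(\varphi)\mid\varphi\in I\rangle$ for an interval $I\subset\mathbb R$; the heart of $\sigma$ is the abelian category $\mathcal A_\sigma=\mathcal P_\sigma(0,1]$. Call $\sigma$ locally finite if for every $t\in\mathbb R$ there is $\epsilon\in(0,\tfrac12)$ such that the quasi-abelian category $\mathcal P_\sigma(t-\epsilon,t+\epsilon)$ is artinian and noetherian with respect to strict subobjects. Let $\operatorname{Stab}(\mathcal C)$ be the set of locally finite stability conditions with the topology of the generalised metric $$d(\sigma,\tau)=\sup_{0\ne c\in\mathcal C}\max\Big\{|\varphi_\sigma^-(c)-\varphi_\tau^-(c)|,\ |\varphi_\sigma^+(c)-\varphi_\tau^+(c)|,\ \Big|\log\frac{m_\sigma(c)}{m_\tau(c)}\Big|\Big\}\in[0,\infty].$$ A torsion theory in an abelian category $\mathcal A$ is a pair $(\mathcal T,\mathcal F)$ of strict full subcategories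 with $\operatorname{Hom}(t,f)=0$ for $t\in\mathcal T$, $f\in\mathcal F$, such that every $a\in\mathcal A$ sits in a short exact sequence $0\to t\to a\to f\to0$ in $\mathcal A$ with $t\in\mathcal T$, $f\in\mathcal F$. If $\mathcal A\subset\mathcal C$ is the heart of a $t$-structure, the right tilt of $\mathcal A$ at $\mathcal T$ is $R_{\mathcal T}\mathcal A=\langle\mathcal F[1],\mathcal T\rangle$. **Corollary.** Let $\sigma_n\in\operatorname{Stab}(\mathcal C)$, $n\in\mathbb N$, all have the same heart $\mathcal A_{\sigma_n}=\mathcal A$, and suppose that $\sigma_n\to\sigma$ in $\operatorname{Stab}(\mathcal C)$. Write $\varphi_n^\pm=\varphi_{\sigma_n}^\pm$. Then $$\mathcal T=\langle 0\ne a\in\mathcal A\mid\varphi_n^-(a)\not\to0\rangle,\qquad \mathcal F=\langle 0\ne a\in\mathcal A\mid\varphi_n^+(a)\to0\rangle$$ form a torsion theory $(\mathcal T,\mathcal F)$ in $\mathcal A$, and $\mathcal A_\sigma=R_{\mathcal T}\mathcal A$. -/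

import Mathlib

open CategoryTheory CategoryTheory.Limits CategoryTheory.Pretriangulated Filter Topology
open scoped ENNReal

universe v u

noncomputable section

namespace StabCond

section Basic

variable {C : Type u} [Category.{v} C] [Preadditive C] [HasZeroObject C] [HasShift C ℤ]
  [∀ n : ℤ, (shiftFunctor C n).Additive] [Pretriangulated C]

/-- The full, strict, extension-closed subcategory `⟨S⟩` of the triangulated category `C` generated
by the objects isomorphic to an object of `S`. As a subcategory of an additive category it contains
the zero objects (the empty extensions), also when `S` is empty. -/
inductive extClosure (S : ObjectProperty C) : C → Prop
  | zero (X : C) (hX : IsZero X) : extClosure S X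
  | of_iso (X Y : C) (e : X ≅ Y) (hX : S X) : extClosure S Y
  | ext (X Y Z : C) (f : X ⟶ Y) (g : Y ⟶ Z) (h : Z ⟶ X⟦(1 : ℤ)⟧)
      (hT : Triangle.mk f g h ∈ distTriang C)
      (hX : extClosure S X) (hZ : extClosure S Z) : extClosure S Y

/-- A filtration of the kind required of Harder--Narasimhan filtrations, for a family `P φ` of
subcategories. It has `n + 1` factors (`n : ℕ`), so there is at least one; indices start at `0`.
The factor `b i` is the third vertex of a triangle on `c i → c (i + 1)`; factors are nonzero. -/
structure HNFiltration (P : ℝ → ObjectProperty C) (X : C) where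
  n : ℕ
  obj : Fin (n + 2) → C
  factor : Fin (n + 1) → C
  phase : Fin (n + 1) → ℝ
  obj_first : IsZero (obj 0)
  obj_last : obj (Fin.last (n + 1)) ≅ X
  triangle : ∀ i : Fin (n + 1), ∃ (f : obj i.castSucc ⟶ obj i.succ) (g : obj i.succ ⟶ factor i)
    (h : factor i ⟶ (obj i.castSucc)⟦(1 : ℤ)⟧), Triangle.mk f g h ∈ distTriang C
  factor_mem : ∀ i, P (phase i) (factor i)
  factor_ne_zero : ∀ i, ¬ IsZero (factor i)
  phase_strictAnti : StrictAnti phase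

variable (C) in
/-- The Grothendieck group: the free abelian group on the objects, modulo `[Y] = [X] + [Z]` for
every exact triangle `X → Y → Z → X[1]`. -/
abbrev GrothendieckGroup : Type u :=
  FreeAbelianGroup C ⧸ AddSubgroup.closure
    {x : FreeAbelianGroup C | ∃ T ∈ distTriang C,
      x = FreeAbelianGroup.of T.obj₂ - (FreeAbelianGroup.of T.obj₁ + FreeAbelianGroup.of T.obj₃)}

/-- The class of an object in the Grothendieck group. -/
def cls (X : C) : GrothendieckGroup C := QuotientAddGroup.mk (FreeAbelianGroup.of X)

variable (C) in
/-- A stability condition on the triangulated category `C`. -/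
structure StabilityCondition where
  /-- the central charge -/
  Z : GrothendieckGroup C →+ ℂ
  /-- `P φ` is the full additive subcategory of semistable objects of phase `φ` -/
  P : ℝ → ObjectProperty C
  P_iso : ∀ φ, (P φ).IsClosedUnderIsomorphisms
  P_zero : ∀ φ, (P φ).ContainsZero
  P_sum : ∀ φ, (P φ).IsClosedUnderFiniteProducts
  charge : ∀ (φ : ℝ) (X : C), P φ X → ¬ IsZero X →
    ∃ m : ℝ, 0 < m ∧ Z (cls X) = m * Complex.exp (Complex.I * Real.pi * φ)
  /-- `P (φ + 1) = P φ [1]` -/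
  shift_phase : ∀ (φ : ℝ) (X : C), P (φ + 1) X ↔ P φ (X⟦(-1 : ℤ)⟧)
  hom_eq_zero : ∀ (φ ψ : ℝ) (X Y : C), ψ < φ → P φ X → P ψ Y → ∀ f : X ⟶ Y, f = 0
  exists_HN : ∀ X : C, ¬ IsZero X → Nonempty (HNFiltration P X)

namespace StabilityCondition

variable (σ : StabilityCondition C)

/-- A Harder--Narasimhan filtration of a nonzero object (it is unique up to isomorphism). -/
def hn (X : C) (hX : ¬ IsZero X) : HNFiltration σ.P X := (σ.exists_HN X hX).some

open Classical in
/-- `φ⁺(X)`: the phase of the first Harder--Narasimhan factor of the nonzero object `X`. -/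
def phiPlus (X : C) : ℝ := if hX : IsZero X then 0 else (σ.hn X hX).phase 0

open Classical in
/-- `φ⁻(X)`: the phase of the last Harder--Narasimhan factor of the nonzero object `X`. -/
def phiMinus (X : C) : ℝ :=
  if hX : IsZero X then 0 else (σ.hn X hX).phase (Fin.last (σ.hn X hX).n)

open Classical in
/-- The mass of a nonzero object: the sum of the `|Z(b)|` over its Harder--Narasimhan factors
`b`. -/
def mass (X : C) : ℝ :=
  if hX : IsZero X then 0 else ∑ i, ‖σ.Z (cls ((σ.hn X hX).factor i))‖

lemma mass_pos (X : C) (hX : ¬ IsZero X) : 0 < σ.mass X := by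
  rw [mass, dif_neg hX]
  refine Finset.sum_pos (fun i _ => ?_) Finset.univ_nonempty
  obtain ⟨m, hm, h⟩ := σ.charge _ _ ((σ.hn X hX).factor_mem i) ((σ.hn X hX).factor_ne_zero i)
  rw [h, norm_pos_iff]
  exact mul_ne_zero (by exact_mod_cast hm.ne') (Complex.exp_ne_zero _)

/-- `P(I)`: the extension-closed subcategory generated by the semistable objects with phase
in `I`. -/
def interval (I : Set ℝ) : ObjectProperty C := extClosure fun X => ∃ φ ∈ I, σ.P φ X

/-- The heart `P(0, 1]` of a stability condition. -/
def heart : ObjectProperty C := σ.interval (Set.Ioc 0 1)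

end StabilityCondition

/-- A morphism `f : a ⟶ b` of a full subcategory `Q` of `C` is a strict monomorphism if it is part
of an exact triangle `a → b → c → a[1]` with `c` in `Q` too. (For `Q = P(I)` with `I` an interval
of length `< 1` these are the strict monomorphisms of the quasi-abelian category `P(I)`.) -/
def IsStrictMono (Q : ObjectProperty C) {a b : Q.FullSubcategory} (f : a ⟶ b) : Prop :=
  ∃ (c : C) (g : b.obj ⟶ c) (h : c ⟶ a.obj⟦(1 : ℤ)⟧), Q c ∧ Triangle.mk f.hom g h ∈ distTriang C

/-- The poset of strict subobjects of an object of `Q`. -/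
abbrev StrictSubobject (Q : ObjectProperty C) (b : Q.FullSubcategory) : Type (max u v) :=
  {x : Subobject b // IsStrictMono Q x.arrow}

/-- `σ` is locally finite: every `t` has a neighbourhood `(t - ε, t + ε)`, of length `< 1`, for
which the quasi-abelian category `P(t - ε, t + ε)` is artinian and noetherian, i.e. has no infinite
strictly descending or ascending chains of strict subobjects of an object. -/
def StabilityCondition.IsLocallyFinite (σ : StabilityCondition C) : Prop :=
  ∀ t : ℝ, ∃ ε : ℝ, 0 < ε ∧ ε < 1 / 2 ∧
    ∀ b : (σ.interval (Set.Ioo (t - ε) (t + ε))).FullSubcategory,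
      WellFoundedLT (StrictSubobject (σ.interval (Set.Ioo (t - ε) (t + ε))) b) ∧
      WellFoundedGT (StrictSubobject (σ.interval (Set.Ioo (t - ε) (t + ε))) b)

variable (C) in
/-- The set of locally finite stability conditions on `C`. -/
def Stab : Type u := {σ : StabilityCondition C // σ.IsLocallyFinite}

/-- The generalised metric on stability conditions, with values in `[0, ∞]`. -/
def stabDist (σ τ : StabilityCondition C) : ℝ≥0∞ :=
  ⨆ (X : C) (_ : ¬ IsZero X), ENNReal.ofReal
    (max (max |σ.phiMinus X - τ.phiMinus X| |σ.phiPlus X - τ.phiPlus X|)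
      |Real.log (σ.mass X / τ.mass X)|)

/-- The space of stability conditions, with the topology given by the generalised metric. -/
instance : PseudoEMetricSpace (Stab C) where
  edist σ τ := stabDist σ.1 τ.1
  edist_self σ := by
    simp only [stabDist, sub_self, abs_zero, max_self, ENNReal.iSup_eq_zero]
    intro X hX
    simp [div_self (σ.1.mass_pos X hX).ne']
  edist_comm σ τ := by
    simp only [stabDist]
    refine iSup_congr fun X => iSup_congr fun hX => ?_
    rw [abs_sub_comm (σ.1.phiMinus X), abs_sub_comm (σ.1.phiPlus X), ← inv_div, Real.log_inv,
      abs_neg]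
  edist_triangle σ τ ρ := by
    simp only [stabDist]
    refine iSup₂_le fun X hX => ?_
    refine le_trans ?_ (add_le_add
      (le_iSup₂ (f := fun (X : C) (_ : ¬ IsZero X) => ENNReal.ofReal
        (max (max |σ.1.phiMinus X - τ.1.phiMinus X| |σ.1.phiPlus X - τ.1.phiPlus X|)
          |Real.log (σ.1.mass X / τ.1.mass X)|)) X hX)
      (le_iSup₂ (f := fun (X : C) (_ : ¬ IsZero X) => ENNReal.ofReal
        (max (max |τ.1.phiMinus X - ρ.1.phiMinus X| |τ.1.phiPlus X - ρ.1.phiPlus X|)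
          |Real.log (τ.1.mass X / ρ.1.mass X)|)) X hX))
    rw [← ENNReal.ofReal_add (le_max_of_le_right (abs_nonneg _))
      (le_max_of_le_right (abs_nonneg _))]
    refine ENNReal.ofReal_le_ofReal ?_
    have h1 := (σ.1.mass_pos X hX).ne'
    have h2 := (τ.1.mass_pos X hX).ne'
    have h3 := (ρ.1.mass_pos X hX).ne'
    rw [Real.log_div h1 h3, Real.log_div h1 h2, Real.log_div h2 h3]
    refine max_le (max_le ?_ ?_) ?_
    · exact (abs_sub_le _ _ _).trans (add_le_add (le_max_of_le_left (le_max_left _ _))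
        (le_max_of_le_left (le_max_left _ _)))
    · exact (abs_sub_le _ _ _).trans (add_le_add (le_max_of_le_left (le_max_right _ _))
        (le_max_of_le_left (le_max_right _ _)))
    · exact (abs_sub_le _ _ _).trans (add_le_add (le_max_right _ _) (le_max_right _ _))

/-- `U(A)`: the locally finite stability conditions with heart `A`. -/
def U (A : ObjectProperty C) : Set (Stab C) := {σ | σ.1.heart = A}

/-- `(T, F)` is a torsion theory in the abelian category `A`, a full subcategory of `C`: there are
no nonzero morphisms from `T` to `F`, and every `a` in `A` sits in a short exact sequence
`0 → t → a → f → 0` of `A` with `t` in `T` and `f` in `F`. -/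
structure IsTorsionTheory (A T F : ObjectProperty C) : Prop where
  T_le : T ≤ A
  F_le : F ≤ A
  T_iso : T.IsClosedUnderIsomorphisms
  F_iso : F.IsClosedUnderIsomorphisms
  hom_eq_zero : ∀ (t f : C), T t → F f → ∀ g : t ⟶ f, g = 0
  exists_shortExact : ∀ a : A.FullSubcategory, ∃ (t f : A.FullSubcategory) (i : t ⟶ a) (p : a ⟶ f)
    (w : i ≫ p = 0), T t.obj ∧ F f.obj ∧ (ShortComplex.mk i p w).ShortExact

/-- The right tilt `R_T A = ⟨F[1], T⟩` of a heart `A` at a torsion theory `(T, F)` in `A`.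
(`F.shift (-1)` consists of the `X` with `X[-1]` in `F`, so it is `F[1]`.) -/
def rightTilt (T F : ObjectProperty C) : ObjectProperty C := extClosure (F.shift (-1 : ℤ) ⊔ T)

/-- `⟨0 ≠ a ∈ A | φₙ⁻(a) does not tend to 0⟩`. -/
def limitT (A : ObjectProperty C) (σ : ℕ → Stab C) : ObjectProperty C :=
  extClosure fun a => ¬ IsZero a ∧ A a ∧
    ¬ Tendsto (fun n => (σ n).1.phiMinus a) atTop (𝓝 0)

/-- `⟨0 ≠ a ∈ A | φₙ⁺(a) → 0⟩`. -/
def limitF (A : ObjectProperty C) (σ : ℕ → Stab C) : ObjectProperty C :=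
  extClosure fun a => ¬ IsZero a ∧ A a ∧
    Tendsto (fun n => (σ n).1.phiPlus a) atTop (𝓝 0)

end Basic

end StabCond

end

/-! Phases vary continuously: the metric dominates the change of φ⁻ and φ⁺ of every nonzero object.
On nonzero objects of A all phases of σₙ lie in (0, 1], so those of the limit lie in [0, 1], that
is, A ⊆ P_τ[0, 1] (`le_interval_Icc_of_tendsto`).

The rest compares two stability conditions s, t with P_s(0, 1] ⊆ P_t[0, 1]. Shifting gives P_s(>0) ⊆
P_t(≥0) and P_s(≤0) ⊆ P_t(≤0). Taking orthogonals gives P_t(>0) ⊆ P_s(>0) and P_t(<0) ⊆ P_s(≤0).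
Truncating an object of the heart of s at t-phase 0 then yields its torsion sequence, with pieces in
P_t(0, 1] and P_t(0) (`isTorsionTheory`). Truncating an object of the heart of t at s-phase 1
exhibits it as an extension of a torsion object by a shifted torsion-free one
(`heart_eq_rightTilt`).

Finally, the limit of φₙ⁻(a) is φ_τ⁻(a) ≥ 0, and likewise for φ⁺. So the subcategories defined by
limits are A ∩ P_τ(0, 1] and A ∩ P_τ(0) (`limitT_eq`, `limitF_eq`). -/

namespace StabCond

section

open ZeroObject

variable {C : Type u} [Category.{v} C] [Preadditive C] [HasZeroObject C] [HasShift C ℤ]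
  [∀ n : ℤ, (shiftFunctor C n).Additive] [Pretriangulated C]

/-! ### Extension closures and vanishing of morphisms -/

namespace extClosure

lemma of_distTriang {S : ObjectProperty C} {T : Triangle C} (hT : T ∈ distTriang C)
    (h₁ : extClosure S T.obj₁) (h₃ : extClosure S T.obj₃) : extClosure S T.obj₂ :=
  .ext _ _ _ T.mor₁ T.mor₂ T.mor₃ hT h₁ h₃

lemma subset {S : ObjectProperty C} {X : C} (hX : S X) : extClosure S X :=
  .of_iso X X (Iso.refl X) hX

/-- An isomorphism completes to a triangle with third vertex 0, so Y is an extension of 0 by X. -/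
lemma congr_iso {S : ObjectProperty C} {X Y : C} (e : X ≅ Y) (hX : extClosure S X) :
    extClosure S Y := by
  have hT : Triangle.mk e.hom (0 : Y ⟶ 0) 0 ∈ distTriang C :=
    (Triangle.distinguished_iff_of_isZero₃ _ (isZero_zero C)).2
      (inferInstanceAs (IsIso e.hom))
  exact .ext _ _ _ _ _ _ hT hX (.zero _ (isZero_zero C))

lemma bind {S S' : ObjectProperty C} (h : ∀ X, S X → extClosure S' X) {X : C}
    (hX : extClosure S X) : extClosure S' X := by
  induction hX with
  | zero X hX => exact .zero X hX
  | of_iso X Y e hX => exact (h X hX).congr_iso e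
  | ext X Y Z f g k hT _ _ h₁ h₃ => exact .ext X Y Z f g k hT h₁ h₃

lemma shift {S S' : ObjectProperty C} (n : ℤ) (h : ∀ X, S X → extClosure S' (X⟦n⟧)) {X : C}
    (hX : extClosure S X) : extClosure S' (X⟦n⟧) := by
  induction hX with
  | zero X hX => exact .zero _ ((shiftFunctor C n).map_isZero hX)
  | of_iso X Y e hX => exact (h X hX).congr_iso ((shiftFunctor C n).mapIso e)
  | ext X Y Z f g k hT _ _ h₁ h₃ =>
    exact of_distTriang (Triangle.shift_distinguished _ hT n) h₁ h₃

lemma hom_eq_zero_left {S : ObjectProperty C} {Y : C} (h : ∀ X, S X → ∀ f : X ⟶ Y, f = 0)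
    {X : C} (hX : extClosure S X) (f : X ⟶ Y) : f = 0 := by
  induction hX with
  | zero X hX => exact hX.eq_of_src _ _
  | of_iso X X' e hX => rw [← cancel_epi e.hom, comp_zero]; exact h X hX _
  | ext X₁ X₂ X₃ a b c hT _ _ h₁ h₃ =>
    obtain ⟨g, rfl⟩ := Triangle.yoneda_exact₂ _ hT f (h₁ _)
    exact (congrArg (b ≫ ·) (h₃ g)).trans comp_zero

lemma hom_eq_zero {S S' : ObjectProperty C} (h : ∀ X Y, S X → S' Y → ∀ f : X ⟶ Y, f = 0)
    {X Y : C} (hX : extClosure S X) (hY : extClosure S' Y) (f : X ⟶ Y) : f = 0 := by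
  induction hY with
  | zero Y hY => exact hY.eq_of_tgt _ _
  | of_iso Y Y' e hY =>
    rw [← cancel_mono e.inv, zero_comp]
    exact hom_eq_zero_left (fun X hX => h X Y hX hY) hX _
  | ext X₁ X₂ X₃ a b c hT _ _ h₁ h₃ =>
    obtain ⟨g, rfl⟩ := Triangle.coyoneda_exact₂ _ hT f (h₃ _)
    exact (congrArg (· ≫ a) (h₁ g)).trans zero_comp

end extClosure

/-- If the first map vanishes, the identity of `T.obj₁⟦1⟧` factors through `T.obj₃`, by a map that
is zero by hypothesis. -/
lemma isZero₁_of_mor₁_eq_zero {T : Triangle C} (hT : T ∈ distTriang C) (h₁ : T.mor₁ = 0)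
    (h : ∀ f : T.obj₁⟦(1 : ℤ)⟧ ⟶ T.obj₃, f = 0) : IsZero T.obj₁ := by
  obtain ⟨g, hg⟩ := Triangle.coyoneda_exact₁ T hT (𝟙 _) (by simp [h₁])
  rw [h g, zero_comp] at hg
  rw [IsZero.iff_id_eq_zero]
  apply (shiftFunctor C (1 : ℤ)).map_injective
  rw [CategoryTheory.Functor.map_id, hg, Functor.map_zero]

lemma isZero₃_of_mor₂_eq_zero {T : Triangle C} (hT : T ∈ distTriang C) (h₂ : T.mor₂ = 0)
    (h : ∀ f : T.obj₁⟦(1 : ℤ)⟧ ⟶ T.obj₃, f = 0) : IsZero T.obj₃ := by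
  obtain ⟨g, hg⟩ := Triangle.yoneda_exact₃ T hT (𝟙 _) (by simp [h₂])
  rw [h g, comp_zero] at hg
  exact (IsZero.iff_id_eq_zero _).2 hg

/-! ### Truncating Harder–Narasimhan filtrations -/

namespace HNFiltration

variable {P : ℝ → ObjectProperty C} {X : C} (F : HNFiltration P X)

/-- By the octahedral axiom, passing from k to k + 1 extends the cone by the factor with index k. -/
lemma exists_triangle_obj [IsTriangulated C] (j k : ℕ) (hjk : j ≤ k) (hk : k < F.n + 2) :
    ∃ (Y : C) (f : F.obj ⟨j, hjk.trans_lt hk⟩ ⟶ F.obj ⟨k, hk⟩) (g : F.obj ⟨k, hk⟩ ⟶ Y)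
      (h : Y ⟶ (F.obj ⟨j, hjk.trans_lt hk⟩)⟦(1 : ℤ)⟧), Triangle.mk f g h ∈ distTriang C ∧
      extClosure (fun b => ∃ i : Fin (F.n + 1), j ≤ i.1 ∧ i.1 < k ∧ P (F.phase i) b) Y := by
  induction k, hjk using Nat.le_induction with
  | base => exact ⟨0, 𝟙 _, 0, 0, contractible_distinguished _, .zero _ (isZero_zero C)⟩
  | succ k hjk ih =>
    obtain ⟨Y, f, g, h, hT, hY⟩ := ih (by omega)
    obtain ⟨f', g', h', hT'⟩ := F.triangle ⟨k, by omega⟩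
    obtain ⟨Y', g'', h'', hT''⟩ := distinguished_cocone_triangle (f ≫ f')
    let o := Triangulated.someOctahedron rfl hT hT' hT''
    refine ⟨Y', f ≫ f', g'', h'', hT'', extClosure.of_distTriang o.mem ?_ ?_⟩
    · refine hY.bind fun b ⟨i, h₁, h₂, h₃⟩ => .subset ⟨i, h₁, by omega, h₃⟩
    · exact .subset ⟨⟨k, by omega⟩, hjk, by simp, F.factor_mem _⟩

lemma obj_mem [IsTriangulated C] (k : ℕ) (hk : k < F.n + 2) :
    extClosure (fun b => ∃ i : Fin (F.n + 1), i.1 < k ∧ P (F.phase i) b) (F.obj ⟨k, hk⟩) := by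
  obtain ⟨Y, f, g, h, hT, hY⟩ := F.exists_triangle_obj 0 k k.zero_le hk
  exact .ext _ _ _ _ _ _ hT (.zero _ F.obj_first)
    (hY.bind fun b ⟨i, _, h₂, h₃⟩ => .subset ⟨i, h₂, h₃⟩)

lemma exists_triangle [IsTriangulated C] (j : ℕ) (hj : j < F.n + 2) :
    ∃ (Y : C) (f : F.obj ⟨j, hj⟩ ⟶ X) (g : X ⟶ Y) (h : Y ⟶ (F.obj ⟨j, hj⟩)⟦(1 : ℤ)⟧),
      Triangle.mk f g h ∈ distTriang C ∧
      extClosure (fun b => ∃ i : Fin (F.n + 1), j ≤ i.1 ∧ P (F.phase i) b) Y := by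
  obtain ⟨Y, f, g, h, hT, hY⟩ := F.exists_triangle_obj j (F.n + 1) (by omega) (by omega)
  let e : F.obj ⟨F.n + 1, by omega⟩ ≅ X := F.obj_last
  refine ⟨Y, f ≫ e.hom, e.inv ≫ g, h, isomorphic_distinguished _ hT _ ?_,
    hY.bind fun b ⟨i, h₁, _, h₃⟩ => .subset ⟨i, h₁, h₃⟩⟩
  refine Triangle.isoMk _ _ (Iso.refl _) e.symm (Iso.refl _) ?_ ?_ ?_
  · change (f ≫ e.hom) ≫ e.inv = 𝟙 _ ≫ f
    simp
  · change (e.inv ≫ g) ≫ 𝟙 _ = e.inv ≫ g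
    simp
  · change h ≫ (𝟙 _)⟦(1 : ℤ)⟧' = 𝟙 _ ≫ h
    simp

end HNFiltration

/-! ### Interval subcategories and extremal phases -/

namespace StabilityCondition

variable (σ : StabilityCondition C)

lemma P_shift_one {φ : ℝ} {X : C} (hX : σ.P φ X) : σ.P (φ + 1) (X⟦(1 : ℤ)⟧) := by
  have := σ.P_iso φ
  exact (σ.shift_phase φ _).2 ((σ.P φ).prop_of_iso (shiftShiftNeg X (1 : ℤ)).symm hX)

lemma P_shift_neg_one {φ : ℝ} {X : C} (hX : σ.P φ X) : σ.P (φ - 1) (X⟦(-1 : ℤ)⟧) :=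
  (σ.shift_phase (φ - 1) X).1 (by rwa [sub_add_cancel])

variable {σ}

lemma interval_mono {I J : Set ℝ} (h : I ⊆ J) {X : C} (hX : σ.interval I X) :
    σ.interval J X :=
  extClosure.bind (fun _ ⟨φ, hφ, hX⟩ => .subset ⟨φ, h hφ, hX⟩) hX

lemma interval_shift_one {I J : Set ℝ} (h : ∀ x ∈ I, x + 1 ∈ J) {X : C}
    (hX : σ.interval I X) : σ.interval J (X⟦(1 : ℤ)⟧) :=
  extClosure.shift 1 (fun _ ⟨φ, hφ, hX⟩ => .subset ⟨φ + 1, h φ hφ, σ.P_shift_one hX⟩) hX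

lemma interval_shift_neg_one {I J : Set ℝ} (h : ∀ x ∈ I, x - 1 ∈ J) {X : C}
    (hX : σ.interval I X) : σ.interval J (X⟦(-1 : ℤ)⟧) :=
  extClosure.shift (-1) (fun _ ⟨φ, hφ, hX⟩ => .subset ⟨φ - 1, h φ hφ, σ.P_shift_neg_one hX⟩) hX

lemma interval_of_shift_neg_one {I J : Set ℝ} (h : ∀ x ∈ I, x + 1 ∈ J) {X : C}
    (hX : σ.interval I (X⟦(-1 : ℤ)⟧)) : σ.interval J X :=
  (interval_shift_one h hX).congr_iso (shiftNegShift X (1 : ℤ))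

lemma interval_of_shift_one {I J : Set ℝ} (h : ∀ x ∈ I, x - 1 ∈ J) {X : C}
    (hX : σ.interval I (X⟦(1 : ℤ)⟧)) : σ.interval J X :=
  (interval_shift_neg_one h hX).congr_iso (shiftShiftNeg X (1 : ℤ))

lemma interval_hom_eq_zero {I J : Set ℝ} (h : ∀ x ∈ I, ∀ y ∈ J, y < x) {X Y : C}
    (hX : σ.interval I X) (hY : σ.interval J Y) (f : X ⟶ Y) : f = 0 :=
  extClosure.hom_eq_zero (fun X Y ⟨φ, hφ, hX⟩ ⟨ψ, hψ, hY⟩ =>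
    σ.hom_eq_zero φ ψ X Y (h φ hφ ψ hψ) hX hY) hX hY f

section

lemma phiMinus_le_phiPlus (X : C) : σ.phiMinus X ≤ σ.phiPlus X := by
  rw [phiMinus, phiPlus]
  split_ifs with hX
  · exact le_rfl
  · exact (σ.hn X hX).phase_strictAnti.antitone (Fin.zero_le _)

variable [IsTriangulated C]

lemma interval_phi {X : C} (hX : ¬ IsZero X) :
    σ.interval (Set.Icc (σ.phiMinus X) (σ.phiPlus X)) X := by
  rw [phiMinus, phiPlus, dif_neg hX, dif_neg hX]
  let F := σ.hn X hX
  refine extClosure.congr_iso F.obj_last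
    ((F.obj_mem (F.n + 1) (by omega)).bind fun b ⟨i, _, hb⟩ => .subset ⟨_, ⟨?_, ?_⟩, hb⟩)
  · exact F.phase_strictAnti.antitone (Fin.le_last i)
  · exact F.phase_strictAnti.antitone (Fin.zero_le i)

/-- The map from X to its last factor cannot vanish: the shift of the preceding step has larger
phases than this factor, so otherwise the factor would be zero. Hence its phase cannot lie outside
U. -/
lemma phiMinus_mem {X : C} (hX : ¬ IsZero X) {U : Set ℝ}
    (h : ∀ Y, σ.interval Uᶜ Y → ∀ f : X ⟶ Y, f = 0) : σ.phiMinus X ∈ U := by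
  by_contra hU
  rw [phiMinus, dif_neg hX] at hU
  let F := σ.hn X hX
  obtain ⟨f, g, k, hT⟩ := F.triangle (Fin.last F.n)
  refine F.factor_ne_zero (Fin.last F.n) (isZero₃_of_mor₂_eq_zero hT ?_ fun f => ?_)
  · let e : F.obj (Fin.last F.n).succ ≅ X := F.obj_last
    change g = 0
    rw [← cancel_epi e.inv, comp_zero]
    exact h _ (.subset ⟨_, hU, F.factor_mem _⟩) _
  · have h₁ : σ.interval (Set.Ioi (F.phase (Fin.last F.n))) (F.obj (Fin.last F.n).castSucc) :=
      (F.obj_mem F.n (by omega)).bind fun b ⟨i, hi, hb⟩ =>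
        .subset ⟨_, F.phase_strictAnti (Fin.lt_def.2 hi), hb⟩
    have h₂ : σ.interval {F.phase (Fin.last F.n)} (F.factor (Fin.last F.n)) :=
      .subset ⟨_, rfl, F.factor_mem _⟩
    refine interval_hom_eq_zero (I := Set.Ioi (F.phase (Fin.last F.n))) ?_
      (interval_shift_one ?_ h₁) h₂ f
    · rintro x hx _ rfl
      exact hx
    · intro x hx
      simp only [Set.mem_Ioi] at hx ⊢
      linarith

/-- Dually, the map from the first nonzero step of the filtration to X cannot vanish, since its cone
has phases at most `F.phase 0`. -/
lemma phiPlus_mem {X : C} (hX : ¬ IsZero X) {L : Set ℝ}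
    (h : ∀ Y, σ.interval Lᶜ Y → ∀ f : Y ⟶ X, f = 0) : σ.phiPlus X ∈ L := by
  by_contra hL
  rw [phiPlus, dif_neg hX] at hL
  let F := σ.hn X hX
  have h₁ : σ.interval {F.phase 0} (F.obj ⟨1, by omega⟩) :=
    (F.obj_mem 1 (by omega)).bind fun b ⟨i, hi, hb⟩ => by
      obtain rfl : i = 0 := Fin.ext (by simpa using hi)
      exact .subset ⟨_, rfl, hb⟩
  have hL' : {F.phase 0} ⊆ Lᶜ := Set.singleton_subset_iff.2 hL
  obtain ⟨Y, f, g, k, hT, hY⟩ := F.exists_triangle 1 (by omega)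
  have hY' : σ.interval (Set.Iic (F.phase 0)) Y := hY.bind fun b ⟨i, hi, hb⟩ =>
    .subset ⟨_, F.phase_strictAnti.antitone (Fin.zero_le i), hb⟩
  have h₀ : IsZero (F.obj ⟨1, by omega⟩) := by
    refine isZero₁_of_mor₁_eq_zero hT (h _ (interval_mono hL' h₁) f) fun f => ?_
    refine interval_hom_eq_zero (I := {F.phase 0 + 1}) ?_ (interval_shift_one ?_ h₁) hY' f
    · rintro _ rfl y hy
      simp only [Set.mem_Iic] at hy
      linarith
    · rintro _ rfl
      rfl
  obtain ⟨f, g, k, hT⟩ := F.triangle 0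
  exact F.factor_ne_zero 0 (Triangle.isZero₃_of_isZero₁₂ _ hT F.obj_first h₀)

lemma interval_of_hom_eq_zero_right {U : Set ℝ} (hU : IsUpperSet U) {X : C}
    (h : ∀ Y, σ.interval Uᶜ Y → ∀ f : X ⟶ Y, f = 0) : σ.interval U X := by
  by_cases hX : IsZero X
  · exact .zero _ hX
  · exact interval_mono (I := Set.Icc (σ.phiMinus X) (σ.phiPlus X))
      (fun x hx => hU hx.1 (phiMinus_mem hX h)) (interval_phi hX)

lemma interval_of_hom_eq_zero_left {L : Set ℝ} (hL : IsLowerSet L) {X : C}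
    (h : ∀ Y, σ.interval Lᶜ Y → ∀ f : Y ⟶ X, f = 0) : σ.interval L X := by
  by_cases hX : IsZero X
  · exact .zero _ hX
  · exact interval_mono (I := Set.Icc (σ.phiMinus X) (σ.phiPlus X))
      (fun x hx => hL hx.2 (phiPlus_mem hX h)) (interval_phi hX)

lemma phiMinus_mem_of_interval {U : Set ℝ} (hU : IsUpperSet U) {X : C} (hX : ¬ IsZero X)
    (h : σ.interval U X) : σ.phiMinus X ∈ U :=
  phiMinus_mem hX fun _ hY f => interval_hom_eq_zero (I := U) (J := Uᶜ)
    (fun _ hx _ hy => lt_of_not_ge fun hxy => hy (hU hxy hx)) h hY f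

lemma phiPlus_mem_of_interval {L : Set ℝ} (hL : IsLowerSet L) {X : C} (hX : ¬ IsZero X)
    (h : σ.interval L X) : σ.phiPlus X ∈ L :=
  phiPlus_mem hX fun _ hY f => interval_hom_eq_zero (I := Lᶜ) (J := L)
    (fun _ hx _ hy => lt_of_not_ge fun hxy => hx (hL hxy hy)) hY h f

/-- The two memberships bound φ⁻ and φ⁺ separately, and X is built from semistables with phases
between them. This allows the two ends of a heart to be treated independently. -/
lemma interval_inter {U L : Set ℝ} (hU : IsUpperSet U) (hL : IsLowerSet L) {X : C}
    (h₁ : σ.interval U X) (h₂ : σ.interval L X) : σ.interval (U ∩ L) X := by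
  by_cases hX : IsZero X
  · exact .zero _ hX
  · exact interval_mono (I := Set.Icc (σ.phiMinus X) (σ.phiPlus X))
      (J := U ∩ L) (fun x hx => ⟨hU hx.1 (phiMinus_mem_of_interval hU hX h₁),
        hL hx.2 (phiPlus_mem_of_interval hL hX h₂)⟩) (interval_phi hX)

lemma exists_triangle {U : Set ℝ} (hU : IsUpperSet U) (X : C) :
    ∃ T ∈ distTriang C, T.obj₂ = X ∧ σ.interval U T.obj₁ ∧ σ.interval Uᶜ T.obj₃ := by
  by_cases hX : IsZero X
  · exact ⟨_, contractible_distinguished X, rfl, .zero _ hX, .zero _ (isZero_zero C)⟩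
  obtain ⟨F⟩ := σ.exists_HN X hX
  obtain ⟨j, hj, h₁, h₂⟩ : ∃ j : ℕ, j < F.n + 2 ∧ (∀ i : Fin (F.n + 1), i.1 < j → F.phase i ∈ U) ∧
      ∀ i : Fin (F.n + 1), j ≤ i.1 → F.phase i ∉ U := by
    classical
    -- Cut at the first phase outside U; phases decrease and U is an upper set, so all later ones
    -- are outside too. If there is none, the cut is at the top, `F.n + 1`.
    by_cases h : ∃ k : ℕ, ∃ hk : k < F.n + 1, F.phase ⟨k, hk⟩ ∉ U
    · obtain ⟨hk, hk'⟩ := Nat.find_spec h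
      refine ⟨Nat.find h, by omega, fun i hi => ?_, fun i hi hiU => hk' ?_⟩
      · by_contra hiU
        exact Nat.find_min h hi ⟨i.2, hiU⟩
      · exact hU (F.phase_strictAnti.antitone (Fin.le_def.2 hi)) hiU
    · push Not at h
      exact ⟨F.n + 1, by omega, fun i _ => h i.1 i.2, fun i hi => by omega⟩
  obtain ⟨Y, f, g, k, hT, hY⟩ := F.exists_triangle j hj
  exact ⟨_, hT, rfl,
    (F.obj_mem j hj).bind fun b ⟨i, hi, hb⟩ => .subset ⟨_, h₁ i hi, hb⟩,
    hY.bind fun b ⟨i, hi, hb⟩ => .subset ⟨_, h₂ i hi, hb⟩⟩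

end

/-- By rotation, the third vertex is an extension of `T.obj₁⟦1⟧` by `T.obj₂`. -/
lemma interval_obj₃ {I J : Set ℝ} {T : Triangle C} (hT : T ∈ distTriang C)
    (h₂ : σ.interval J T.obj₂) (h₁ : σ.interval I T.obj₁) (h : ∀ x ∈ I, x + 1 ∈ J) :
    σ.interval J T.obj₃ :=
  extClosure.of_distTriang (rot_of_distTriang _ hT) h₂ (interval_shift_one h h₁)

lemma interval_obj₁ {I J : Set ℝ} {T : Triangle C} (hT : T ∈ distTriang C)
    (h₂ : σ.interval J T.obj₂) (h₃ : σ.interval I T.obj₃) (h : ∀ x ∈ I, x - 1 ∈ J) :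
    σ.interval J T.obj₁ :=
  extClosure.of_distTriang (inv_rot_of_distTriang _ hT) (interval_shift_neg_one h h₃) h₂

section

variable [IsTriangulated C]

lemma heart_iff {X : C} :
    σ.heart X ↔ σ.interval (Set.Ioi 0) X ∧ σ.interval (Set.Iic 1) X :=
  ⟨fun h => ⟨interval_mono (fun _ hx => hx.1) h, interval_mono (fun _ hx => hx.2) h⟩,
    fun h => interval_inter (isUpperSet_Ioi 0) (isLowerSet_Iic 1) h.1 h.2⟩

lemma interval_zero_iff {X : C} :
    σ.interval {0} X ↔ σ.interval (Set.Ici 0) X ∧ σ.interval (Set.Iic 0) X := by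
  refine ⟨fun h => ⟨interval_mono ?_ h, interval_mono ?_ h⟩, fun h => ?_⟩
  · rintro _ rfl
    exact le_refl (0 : ℝ)
  · rintro _ rfl
    exact le_refl (0 : ℝ)
  · exact interval_mono (fun x hx => le_antisymm hx.2 hx.1)
      (interval_inter (isUpperSet_Ici 0) (isLowerSet_Iic 0) h.1 h.2)

lemma heart_hom_shift_one_eq_zero {X Y : C} (hX : σ.heart X) (hY : σ.heart Y)
    (f : X⟦(1 : ℤ)⟧ ⟶ Y) : f = 0 := by
  refine interval_hom_eq_zero (I := Set.Ioi 1) ?_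
    (interval_shift_one ?_ (heart_iff.1 hX).1) (heart_iff.1 hY).2 f
  · intro x hx y hy
    exact lt_of_le_of_lt hy hx
  · intro x hx
    simp only [Set.mem_Ioi] at hx ⊢
    linarith

end

end StabilityCondition

/-! ### From exact triangles to short exact sequences -/

lemma exact_of_isKernel_of_isCokernel {D : Type*} [Category D] [HasZeroMorphisms D]
    [HasZeroObject D] {S : ShortComplex D} (hf : IsLimit (KernelFork.ofι S.f S.zero))
    (hg : IsColimit (CokernelCofork.ofπ S.g S.zero)) : S.Exact := by
  have h₁ : hf.lift (KernelFork.ofι S.f S.zero) = 𝟙 _ :=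
    Fork.IsLimit.hom_ext hf ((hf.fac _ WalkingParallelPair.zero).trans (Category.id_comp _).symm)
  have h₂ : hg.desc (CokernelCofork.ofπ S.g S.zero) = 𝟙 _ :=
    Cofork.IsColimit.hom_ext hg
      ((hg.fac _ WalkingParallelPair.one).trans (Category.comp_id _).symm)
  -- Homology data with K = X₁, Q = X₃ and H = 0: the induced maps X₁ → K and Q → X₃ are identities,
  -- so the cokernel of the one and the kernel of the other are zero.
  exact ⟨{
    left :=
      { K := S.X₁
        H := 0
        i := S.f
        π := 0
        wi := S.zero
        hi := hf
        wπ := comp_zero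
        hπ := CokernelCofork.IsColimit.ofπ _ _ (fun _ _ => 0)
          (fun x hx => by
            rw [comp_zero]
            exact hx.symm.trans ((congrArg (· ≫ x) h₁).trans (Category.id_comp x)))
          (fun _ _ _ _ => (isZero_zero D).eq_of_src _ _) }
    right :=
      { Q := S.X₃
        H := 0
        p := S.g
        ι := 0
        wp := S.zero
        hp := hg
        wι := zero_comp
        hι := KernelFork.IsLimit.ofι _ _ (fun _ _ => 0)
          (fun x hx => by
            rw [zero_comp]
            exact hx.symm.trans ((congrArg (x ≫ ·) h₂).trans (Category.comp_id x)))
          (fun _ _ _ _ => (isZero_zero D).eq_of_tgt _ _) }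
    iso := Iso.refl _
    comm := by
      change 0 ≫ _ = S.f ≫ S.g
      rw [zero_comp, S.zero] }, isZero_zero D⟩

/-- The long exact Hom sequences give factorisations through f and g. The absence of maps X[1] → Y
between objects of A makes f mono and g epi, hence the factorisations unique. -/
lemma shortExact_of_distTriang {A : ObjectProperty C}
    (hA : ∀ X Y, A X → A Y → ∀ f : X⟦(1 : ℤ)⟧ ⟶ Y, f = 0) [HasZeroObject A.FullSubcategory]
    {X Y Z : A.FullSubcategory} (f : X ⟶ Y) (g : Y ⟶ Z) (h : Z.obj ⟶ X.obj⟦(1 : ℤ)⟧)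
    (hT : Triangle.mk f.hom g.hom h ∈ distTriang C) (w : f ≫ g = 0) :
    (ShortComplex.mk f g w).ShortExact := by
  have hf : Mono f := by
    refine Preadditive.mono_of_cancel_zero _ fun {B} k hk => ?_
    have hk' : k.hom ≫ f.hom = 0 := congrArg InducedCategory.Hom.hom hk
    obtain ⟨l, hl⟩ := Triangle.coyoneda_exact₁ _ hT (k.hom⟦(1 : ℤ)⟧') (by
      change k.hom⟦(1 : ℤ)⟧' ≫ f.hom⟦(1 : ℤ)⟧' = 0
      rw [← Functor.map_comp, hk', Functor.map_zero])
    refine ObjectProperty.hom_ext _ ((shiftFunctor C (1 : ℤ)).map_injective ?_)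
    refine hl.trans ?_
    rw [hA _ _ B.property Z.property l]
    exact zero_comp.trans (Functor.map_zero _ _ _).symm
  have hg : Epi g := by
    refine Preadditive.epi_of_cancel_zero _ fun {B} k hk => ?_
    have hk' : g.hom ≫ k.hom = 0 := congrArg InducedCategory.Hom.hom hk
    obtain ⟨l, hl⟩ := Triangle.yoneda_exact₃ _ hT k.hom hk'
    refine ObjectProperty.hom_ext _ (hl.trans ?_)
    rw [hA _ _ X.property B.property l]
    exact comp_zero
  refine ShortComplex.ShortExact.mk' (exact_of_isKernel_of_isCokernel ?_ ?_) hf hg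
  · refine KernelFork.IsLimit.ofι' f w fun {B} k hk => Nonempty.some ?_
    obtain ⟨l, hl⟩ := Triangle.coyoneda_exact₂ _ hT k.hom (congrArg InducedCategory.Hom.hom hk)
    exact ⟨ObjectProperty.homMk l, ObjectProperty.hom_ext _ hl.symm⟩
  · refine CokernelCofork.IsColimit.ofπ' g w fun {B} k hk => Nonempty.some ?_
    obtain ⟨l, hl⟩ := Triangle.yoneda_exact₂ _ hT k.hom (congrArg InducedCategory.Hom.hom hk)
    exact ⟨ObjectProperty.homMk l, ObjectProperty.hom_ext _ hl.symm⟩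

/-! ### Two stability conditions with P_s(0, 1] ⊆ P_t[0, 1] -/

namespace StabilityCondition

variable {s t : StabilityCondition C}

lemma P_le_interval_Icc (h : s.heart ≤ t.interval (Set.Icc 0 1)) (k : ℤ) (φ : ℝ) (X : C)
    (hX : s.P φ X) (hφ : φ ∈ Set.Ioc (k : ℝ) (k + 1)) :
    t.interval (Set.Icc (k : ℝ) (k + 1)) X := by
  induction k using Int.induction_on generalizing φ X with
  | zero =>
    simp only [Int.cast_zero, zero_add] at hφ ⊢
    exact h X (.subset ⟨φ, hφ, hX⟩)
  | succ k ih =>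
    push_cast at hφ ih ⊢
    refine interval_of_shift_neg_one ?_ (ih (φ - 1) _ (s.P_shift_neg_one hX)
      ⟨by linarith [hφ.1], by linarith [hφ.2]⟩)
    exact fun x hx => ⟨by linarith [hx.1], by linarith [hx.2]⟩
  | pred k ih =>
    push_cast at hφ ih ⊢
    refine interval_of_shift_one ?_ (ih (φ + 1) _ (s.P_shift_one hX)
      ⟨by linarith [hφ.1], by linarith [hφ.2]⟩)
    exact fun x hx => ⟨by linarith [hx.1], by linarith [hx.2]⟩

lemma interval_Ioi_le (h : s.heart ≤ t.interval (Set.Icc 0 1)) :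
    s.interval (Set.Ioi 0) ≤ t.interval (Set.Ici 0) := by
  refine fun X hX => extClosure.bind (fun Y ⟨φ, hφ, hY⟩ => ?_) hX
  -- The integer k with k < φ ≤ k + 1 is ⌈φ⌉ - 1.
  have h₀ : (0 : ℤ) ≤ ⌈φ⌉ - 1 := by
    have := Int.ceil_pos.2 (Set.mem_Ioi.1 hφ)
    omega
  refine interval_mono (fun x hx => ?_) (P_le_interval_Icc h (⌈φ⌉ - 1) φ Y hY ⟨?_, ?_⟩)
  · exact (Int.cast_nonneg h₀).trans hx.1
  · push_cast
    linarith [Int.ceil_lt_add_one φ]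
  · push_cast
    linarith [Int.le_ceil φ]

lemma interval_Iic_le (h : s.heart ≤ t.interval (Set.Icc 0 1)) :
    s.interval (Set.Iic 0) ≤ t.interval (Set.Iic 0) := by
  refine fun X hX => extClosure.bind (fun Y ⟨φ, hφ, hY⟩ => ?_) hX
  have h₀ : ((⌈φ⌉ : ℤ) : ℝ) ≤ 0 := by
    have : ⌈φ⌉ ≤ 0 := Int.ceil_le.2 (by simpa using hφ)
    exact_mod_cast this
  refine interval_mono (fun x hx => ?_) (P_le_interval_Icc h (⌈φ⌉ - 1) φ Y hY ⟨?_, ?_⟩)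
  · have := hx.2
    push_cast at this
    exact this.trans (by linarith)
  · push_cast
    linarith [Int.ceil_lt_add_one φ]
  · push_cast
    linarith [Int.le_ceil φ]

variable [IsTriangulated C]

/-- P_s(>0) is the left orthogonal of P_s(≤0), which lies in P_t(≤0) and so receives no nonzero map
from P_t(>0). -/
lemma interval_Ioi_ge (h : s.heart ≤ t.interval (Set.Icc 0 1)) :
    t.interval (Set.Ioi 0) ≤ s.interval (Set.Ioi 0) := fun X hX =>
  interval_of_hom_eq_zero_right (isUpperSet_Ioi 0) fun Y hY f => by
    rw [Set.compl_Ioi] at hY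
    exact interval_hom_eq_zero (fun x hx y hy => lt_of_le_of_lt hy hx) hX
      (interval_Iic_le h Y hY) f

/-- The strict inequality on the t side is needed because P_s(>0) is only known to lie in P_t(≥0).
-/
lemma interval_Iio_ge (h : s.heart ≤ t.interval (Set.Icc 0 1)) :
    t.interval (Set.Iio 0) ≤ s.interval (Set.Iic 0) := fun X hX =>
  interval_of_hom_eq_zero_left (isLowerSet_Iic 0) fun Y hY f => by
    rw [Set.compl_Iic] at hY
    exact interval_hom_eq_zero (fun x hx y hy => lt_of_lt_of_le hy hx)
      (interval_Ioi_le h Y hY) hX f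

lemma interval_zero_le_Iic_one (h : s.heart ≤ t.interval (Set.Icc 0 1)) :
    t.interval {0} ≤ s.interval (Set.Iic 1) := by
  refine fun X hX => interval_of_shift_neg_one ?_ (interval_Iio_ge h _
    (interval_shift_neg_one ?_ hX))
  · intro x hx
    simp only [Set.mem_Iic] at hx ⊢
    linarith
  · rintro _ rfl
    simp

/-- If the heart of `s` is contained in `P_t[0, 1]`, then it has a torsion theory whose torsion
part lies in the heart of `t` and whose torsion-free part lies in `P_t(0)`. -/
lemma isTorsionTheory (h : s.heart ≤ t.interval (Set.Icc 0 1)) :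
    IsTorsionTheory s.heart (s.heart ⊓ t.heart) (s.heart ⊓ t.interval {0}) where
  T_le := inf_le_left
  F_le := inf_le_left
  T_iso := ⟨fun e hX => ⟨extClosure.congr_iso e hX.1, extClosure.congr_iso e hX.2⟩⟩
  F_iso := ⟨fun e hX => ⟨extClosure.congr_iso e hX.1, extClosure.congr_iso e hX.2⟩⟩
  hom_eq_zero X Y hX hY f := by
    refine interval_hom_eq_zero ?_ hX.2 hY.2 f
    rintro x hx _ rfl
    exact hx.1
  exists_shortExact a := by
    -- Truncate at t-phase 0. The missing bounds on each outer vertex follow from a and the other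
    -- outer vertex by rotation, first for t and then for s.
    obtain ⟨T, hT, hTa, h₁, h₃⟩ := t.exists_triangle (isUpperSet_Ioi 0) a.obj
    rw [Set.compl_Ioi] at h₃
    have ha : s.heart T.obj₂ := hTa ▸ a.property
    have ha' := h _ ha
    have h₁s := interval_Ioi_ge h _ h₁
    have h₃t : t.interval {0} T.obj₃ := interval_zero_iff.2
      ⟨interval_obj₃ hT (interval_mono (fun x hx => hx.1) ha') h₁ (fun x hx => by
        simp only [Set.mem_Ioi, Set.mem_Ici] at hx ⊢
        linarith), h₃⟩
    have h₁t : t.interval (Set.Iic 1) T.obj₁ :=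
      interval_obj₁ hT (interval_mono (fun x hx => hx.2) ha') h₃ (fun x hx => by
        simp only [Set.mem_Iic] at hx ⊢
        linarith)
    have h₃s := interval_zero_le_Iic_one h _ h₃t
    have h₁s' : s.interval (Set.Iic 1) T.obj₁ :=
      interval_obj₁ hT (heart_iff.1 ha).2 h₃s (fun x hx => by
        simp only [Set.mem_Iic] at hx ⊢
        linarith)
    have h₃s' : s.interval (Set.Ioi 0) T.obj₃ :=
      interval_obj₃ hT (heart_iff.1 ha).1 h₁s (fun x hx => by
        simp only [Set.mem_Ioi] at hx ⊢
        linarith)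
    have hz : HasZeroObject s.heart.FullSubcategory :=
      ⟨⟨0, .zero _ (isZero_zero C)⟩, (IsZero.iff_id_eq_zero _).2
        (ObjectProperty.hom_ext _ ((isZero_zero C).eq_of_src _ _))⟩
    obtain ⟨a, ha₀⟩ := a
    obtain ⟨X, Y, Z, f, g, k⟩ := T
    obtain rfl : Y = a := hTa
    let X' : s.heart.FullSubcategory := ⟨X, heart_iff.2 ⟨h₁s, h₁s'⟩⟩
    let Y' : s.heart.FullSubcategory := ⟨Y, ha₀⟩
    let Z' : s.heart.FullSubcategory := ⟨Z, heart_iff.2 ⟨h₃s', h₃s⟩⟩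
    have w : (ObjectProperty.homMk f : X' ⟶ Y') ≫ (ObjectProperty.homMk g : Y' ⟶ Z') = 0 :=
      ObjectProperty.hom_ext _ (comp_distTriang_mor_zero₁₂ _ hT)
    exact ⟨X', Z', _, _, w, ⟨X'.property, heart_iff.2 ⟨h₁, h₁t⟩⟩, ⟨Z'.property, h₃t⟩,
      shortExact_of_distTriang (fun _ _ => heart_hom_shift_one_eq_zero) _ _ k hT w⟩

/-- If the heart of `s` is contained in `P_t[0, 1]`, then the heart of `t` is a right tilt of the
heart of `s`. -/
lemma heart_eq_rightTilt (h : s.heart ≤ t.interval (Set.Icc 0 1)) :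
    t.heart = rightTilt (s.heart ⊓ t.heart) (s.heart ⊓ t.interval {0}) := by
  ext X
  refine ⟨fun hX => ?_, fun hX => extClosure.bind ?_ hX⟩
  -- Truncate at s-phase 1: the part with phases > 1 will be the shift of a torsion-free object, the
  -- other part a torsion object.
  · obtain ⟨T, hT, rfl, h₁, h₃⟩ := s.exists_triangle (isUpperSet_Ioi 1) X
    rw [Set.compl_Ioi] at h₃
    obtain ⟨hX₁, hX₂⟩ := heart_iff.1 hX
    have h₁' : s.interval (Set.Ioi 0) (T.obj₁⟦(-1 : ℤ)⟧) := interval_shift_neg_one (fun x hx => by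
      simp only [Set.mem_Ioi] at hx ⊢
      linarith) h₁
    have h₁t : t.interval (Set.Ici 1) T.obj₁ :=
      interval_of_shift_neg_one (fun x hx => by
        simp only [Set.mem_Ici] at hx ⊢
        linarith) (interval_Ioi_le h _ h₁')
    have h₃s : s.heart T.obj₃ := heart_iff.2 ⟨interval_obj₃ hT (interval_Ioi_ge h _ hX₁) h₁
      (fun x hx => by
        simp only [Set.mem_Ioi] at hx ⊢
        linarith), h₃⟩
    have h₃t := h _ h₃s
    have h₃t' : t.heart T.obj₃ := heart_iff.2 ⟨interval_obj₃ hT hX₁ h₁t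
      (fun x hx => by
        simp only [Set.mem_Ioi, Set.mem_Ici] at hx ⊢
        linarith), interval_mono (fun x hx => hx.2) h₃t⟩
    have h₁t' : t.interval (Set.Iic 1) T.obj₁ :=
      interval_obj₁ hT hX₂ (interval_mono (fun x hx => hx.2) h₃t) (I := Set.Iic 1) (fun x hx => by
        simp only [Set.mem_Iic] at hx ⊢
        linarith)
    -- The s-phases of `T.obj₁⟦-1⟧` are positive, so its t-phases are ≥ 0; those of `T.obj₁` are ≤
    -- 1, which leaves only phase 0.
    have h₀ : t.interval {0} (T.obj₁⟦(-1 : ℤ)⟧) := interval_zero_iff.2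
      ⟨interval_Ioi_le h _ h₁', interval_shift_neg_one (fun x hx => by
        simp only [Set.mem_Iic] at hx ⊢
        linarith) h₁t'⟩
    refine extClosure.of_distTriang hT (.subset (Or.inl ⟨?_, h₀⟩))
      (.subset (Or.inr ⟨h₃s, h₃t'⟩))
    exact heart_iff.2 ⟨h₁', interval_zero_le_Iic_one h _ h₀⟩
  · rintro Y (⟨_, hY⟩ | hY)
    · refine interval_of_shift_neg_one ?_ hY
      rintro _ rfl
      simp
    · exact hY.2

end StabilityCondition

/-! ### Passage to the limit -/

open StabilityCondition

lemma edist_phi_le (σ τ : Stab C) {X : C} (hX : ¬ IsZero X) :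
    edist (σ.1.phiMinus X) (τ.1.phiMinus X) ≤ edist σ τ ∧
      edist (σ.1.phiPlus X) (τ.1.phiPlus X) ≤ edist σ τ := by
  have h : ENNReal.ofReal (max (max |σ.1.phiMinus X - τ.1.phiMinus X|
      |σ.1.phiPlus X - τ.1.phiPlus X|) |Real.log (σ.1.mass X / τ.1.mass X)|) ≤ edist σ τ :=
    le_iSup₂ (f := fun (X : C) (_ : ¬ IsZero X) => ENNReal.ofReal
      (max (max |σ.1.phiMinus X - τ.1.phiMinus X| |σ.1.phiPlus X - τ.1.phiPlus X|)
        |Real.log (σ.1.mass X / τ.1.mass X)|)) X hX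
  rw [edist_dist, edist_dist, Real.dist_eq, Real.dist_eq]
  exact ⟨(ENNReal.ofReal_le_ofReal (le_max_of_le_left (le_max_left _ _))).trans h,
    (ENNReal.ofReal_le_ofReal (le_max_of_le_left (le_max_right _ _))).trans h⟩

lemma tendsto_phi {σ : ℕ → Stab C} {τ : Stab C} (h : Tendsto σ atTop (𝓝 τ)) {X : C}
    (hX : ¬ IsZero X) :
    Tendsto (fun n => (σ n).1.phiMinus X) atTop (𝓝 (τ.1.phiMinus X)) ∧
      Tendsto (fun n => (σ n).1.phiPlus X) atTop (𝓝 (τ.1.phiPlus X)) := by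
  rw [tendsto_iff_edist_tendsto_0] at h
  rw [tendsto_iff_edist_tendsto_0, tendsto_iff_edist_tendsto_0]
  exact ⟨tendsto_of_tendsto_of_tendsto_of_le_of_le tendsto_const_nhds h (fun _ => zero_le)
      fun n => (edist_phi_le (σ n) τ hX).1,
    tendsto_of_tendsto_of_tendsto_of_le_of_le tendsto_const_nhds h (fun _ => zero_le)
      fun n => (edist_phi_le (σ n) τ hX).2⟩

section

variable [IsTriangulated C] {A : ObjectProperty C} {σ : ℕ → Stab C} {τ : Stab C}

/-- The strict bound 0 < φₙ⁻ only survives as 0 ≤ φ⁻. Objects with a factor of limit phase 0 are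
what makes a tilt necessary. -/
lemma phi_bounds_of_tendsto (hσ : ∀ n, σ n ∈ U A) (hlim : Tendsto σ atTop (𝓝 τ)) {X : C}
    (hX : ¬ IsZero X) (hA : A X) : 0 ≤ τ.1.phiMinus X ∧ τ.1.phiPlus X ≤ 1 := by
  have h (n : ℕ) : (σ n).1.heart X := by
    rw [show (σ n).1.heart = A from hσ n]
    exact hA
  exact ⟨ge_of_tendsto' (tendsto_phi hlim hX).1 fun n =>
      (phiMinus_mem_of_interval (isUpperSet_Ioi 0) hX (heart_iff.1 (h n)).1).le,
    le_of_tendsto' (tendsto_phi hlim hX).2 fun n =>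
      phiPlus_mem_of_interval (isLowerSet_Iic 1) hX (heart_iff.1 (h n)).2⟩

lemma le_interval_Icc_of_tendsto (hσ : ∀ n, σ n ∈ U A) (hlim : Tendsto σ atTop (𝓝 τ)) :
    A ≤ τ.1.interval (Set.Icc 0 1) := by
  intro X hA
  by_cases hX : IsZero X
  · exact .zero _ hX
  · obtain ⟨h₁, h₂⟩ := phi_bounds_of_tendsto hσ hlim hX hA
    exact interval_mono (Set.Icc_subset_Icc h₁ h₂) (interval_phi hX)

/-- The limit of φₙ⁻ is φ_τ⁻ ≥ 0, so failing to tend to 0 means φ_τ⁻ > 0. Every nonzero object of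
the right side is itself a generator. -/
lemma limitT_eq (hσ : ∀ n, σ n ∈ U A) (hlim : Tendsto σ atTop (𝓝 τ)) :
    limitT A σ = A ⊓ τ.1.heart := by
  ext X
  constructor
  · intro hX
    refine ⟨?_, ?_⟩
    -- As the heart of `σ 0`, A is closed under extensions.
    · rw [← show (σ 0).1.heart = A from hσ 0]
      refine extClosure.bind (fun Y hY => ?_) hX
      have := hY.2.1
      rwa [← show (σ 0).1.heart = A from hσ 0] at this
    · refine extClosure.bind (fun Y hY => ?_) hX
      obtain ⟨h₀, hA, hY⟩ := hY
      obtain ⟨h₁, h₂⟩ := phi_bounds_of_tendsto hσ hlim h₀ hA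
      have h₃ : 0 < τ.1.phiMinus Y := lt_of_le_of_ne h₁ fun h₃ =>
        hY (h₃ ▸ (tendsto_phi hlim h₀).1)
      exact interval_mono (I := Set.Icc (τ.1.phiMinus Y) (τ.1.phiPlus Y)) (J := Set.Ioc 0 1)
        (fun x hx => ⟨h₃.trans_le hx.1, hx.2.trans h₂⟩) (interval_phi h₀)
  · rintro ⟨hA, hX⟩
    by_cases h₀ : IsZero X
    · exact .zero _ h₀
    · refine .subset ⟨h₀, hA, fun h => ?_⟩
      have h₁ := phiMinus_mem_of_interval (isUpperSet_Ioi 0) h₀ (heart_iff.1 hX).1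
      rw [tendsto_nhds_unique (tendsto_phi hlim h₀).1 h] at h₁
      exact lt_irrefl _ (Set.mem_Ioi.1 h₁)

/-- If φₙ⁺ tends to 0, then 0 ≤ φ_τ⁻ ≤ φ_τ⁺ = 0, so only the phase 0 occurs. -/
lemma limitF_eq (hσ : ∀ n, σ n ∈ U A) (hlim : Tendsto σ atTop (𝓝 τ)) :
    limitF A σ = A ⊓ τ.1.interval {0} := by
  ext X
  constructor
  · intro hX
    refine ⟨?_, ?_⟩
    · rw [← show (σ 0).1.heart = A from hσ 0]
      refine extClosure.bind (fun Y hY => ?_) hX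
      have := hY.2.1
      rwa [← show (σ 0).1.heart = A from hσ 0] at this
    · refine extClosure.bind (fun Y hY => ?_) hX
      obtain ⟨h₀, hA, hY⟩ := hY
      obtain ⟨h₁, -⟩ := phi_bounds_of_tendsto hσ hlim h₀ hA
      have h₂ := tendsto_nhds_unique (tendsto_phi hlim h₀).2 hY
      exact interval_mono (fun x hx => le_antisymm (hx.2.trans h₂.le) (h₁.trans hx.1))
        (interval_phi h₀)
  · rintro ⟨hA, hX⟩
    by_cases h₀ : IsZero X
    · exact .zero _ h₀
    · refine .subset ⟨h₀, hA, ?_⟩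
      have h₂ := (interval_zero_iff.1 hX).2
      have h₃ : τ.1.phiPlus X = 0 := by
        exact le_antisymm (phiPlus_mem_of_interval (isLowerSet_Iic 0) h₀ h₂)
          ((phi_bounds_of_tendsto hσ hlim h₀ hA).1.trans (phiMinus_le_phiPlus X))
      exact h₃ ▸ (tendsto_phi hlim h₀).2

end

end

end StabCond

theorem corollary5p3 {C : Type u} [Category.{v} C] [Preadditive C] [HasZeroObject C]
    [HasShift C ℤ] [∀ n : ℤ, (shiftFunctor C n).Additive] [Pretriangulated C] [IsTriangulated C]
    (A : ObjectProperty C) (σ : ℕ → StabCond.Stab C) (τ : StabCond.Stab C)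
    (hσ : ∀ n, σ n ∈ StabCond.U A) (hlim : Tendsto σ atTop (𝓝 τ)) :
    StabCond.IsTorsionTheory A (StabCond.limitT A σ) (StabCond.limitF A σ) ∧
      τ.1.heart = StabCond.rightTilt (StabCond.limitT A σ) (StabCond.limitF A σ) := by
  -- Any member of the sequence can play the role of s; only its heart matters.
  have h₀ : (σ 0).1.heart = A := hσ 0
  have h := StabCond.le_interval_Icc_of_tendsto hσ hlim
  rw [StabCond.limitT_eq hσ hlim, StabCond.limitF_eq hσ hlim]
  subst h₀
  exact ⟨StabCond.StabilityCondition.isTorsionTheory h,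
    StabCond.StabilityCondition.heart_eq_rightTilt h⟩
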